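/- A seminormed nonnegative cone in a Banach space $B$ is a set $M\subset B$ with $cu\in M$ for all $u\in M$, $c\ge 0$, together with a function $[\cdot]:M\to[0,\infty)$ such that $[u]=0$ if and only if $u=0$, and $[cu]=c[u]$ for all $u\in M$, $c\ge 0$. It is continuously embedded in $B$ if $\|u\|_B\le C[u]$ on $M$ for some $C>0$, and compactly embedded in $B$ if every sequence in $M$ with bounded $[\cdot]$ is relatively compact in $B$. Proposition (Discrete Aubin–Lions–Dubinskiĭ). Let $B$ and $Y_n$ $(n\in\mathbb N)$ be Banach spaces, all of them linear subspaces of one vector space (no continuity of embeddings between $B$ and $Y_n$ is assumed), and let $M_n$ be seminormed nonnegative cones in $B$ with functions $[\cdot]_n$, each continuously embedded in $B$. Assume: (a) if $w_n\in M_n$ for all $n$ and $\sup_n[w_n]_n<\infty$, then $(w_n)$ is relatively compact in $B$; (b) for all indices $n_1<n_2<\cdots$ and all $x_k,y_k\in M_{n_k}\cap Y_{n_k}$: if $x_k-y_k\to w$ in $B$ and $\|x_k-y_k\|_{Y_{n_k}}\to 0$ as $k\to\infty$, then $w=0$. Let $1\le p\le\infty$, $T>0$, and let $u_n\in L^p(0,T;M_n\cap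 Y_n)$, that is, $u_n$ is strongly measurable in $B$ and in $Y_n$, $u_n(t)\in M_n\cap Y_n$ for a.e. $t\in(0,T)$, and $t\mapsto[u_n(t)]_n$ belongs to $L^p(0,T)$. Suppose that (i) there exists $C>0$ such that $\|u_n\|_{L^p(0,T;M_n)}:=\big\|[u_n(\cdot)]_n\big\|_{L^p(0,T)}\le C$ for all $n$; (ii) $\|u_n(\cdot+h)-u_n\|_{L^p(0,T-h;Y_n)}\to 0$ as $h\to 0^+$, uniformly in $n$. Then $(u_n)$ is relatively compact in $L^p(0,T;B)$. If $p=\infty$ and, in addition, for each fixed $n$, $M_n$ is compactly embedded in $B$ and condition (b) holds with $n_k=n$ for all $k$, then each $u_n$ agrees almost everywhere with a function in $C([0,T];B)$, and $(u_n)$ is relatively compact in $C([0,T];B)$. -/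

import Mathlib

open MeasureTheory Filter Topology Set
open scoped ENNReal NNReal

/-- A seminormed nonnegative cone in a Banach space `B`: a set closed under multiplication by
nonnegative reals, with a positively homogeneous, definite function `[·]` on it. No additivity of
the set and no triangle inequality are required. Values of `semi` outside the cone are irrelevant. -/
structure SeminormedCone (B : Type*) [NormedAddCommGroup B] [NormedSpace ℝ B] where
  carrier : Set B
  semi : B → ℝ
  smul_mem : ∀ u ∈ carrier, ∀ c : ℝ, 0 ≤ c → c • u ∈ carrier
  semi_nonneg : ∀ u ∈ carrier, 0 ≤ semi u
  semi_eq_zero_iff : ∀ u ∈ carrier, (semi u = 0 ↔ u = 0)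
  semi_smul : ∀ u ∈ carrier, ∀ c : ℝ, 0 ≤ c → semi (c • u) = c * semi u

section

variable {B : Type*} [NormedAddCommGroup B] [NormedSpace ℝ B]

/-- `M ↪ B` continuously. -/
def SeminormedCone.ContinuouslyEmbedded (M : SeminormedCone B) : Prop :=
  ∃ C : ℝ, 0 < C ∧ ∀ u ∈ M.carrier, ‖u‖ ≤ C * M.semi u

/-- Compactness along the sequence of cones `M (ν 0), M (ν 1), …`: whenever `w k ∈ M (ν k)` has
bounded seminorms `[w k]`, the sequence `w` is relatively compact in `B`.
For a constant `ν` with value `n` this says that `M n ↪ B` compactly. -/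
def CompactAlong (M : ℕ → SeminormedCone B) (ν : ℕ → ℕ) : Prop :=
  ∀ w : ℕ → B, (∀ k, w k ∈ (M (ν k)).carrier) →
    (∃ C : ℝ, ∀ k, (M (ν k)).semi (w k) ≤ C) → IsCompact (closure (range w))

variable {E : Type*} [AddCommGroup E] [Module ℝ E]

section

variable {Y : Type*} [NormedAddCommGroup Y] [NormedSpace ℝ Y]

/-- `B` and `Y` are regarded as linear subspaces of a vector space `E` through `ι` and `j`;
`InSpace ι j x` says that the element `x` of `B` belongs to `Y`. -/
def InSpace (ι : B →ₗ[ℝ] E) (j : Y →ₗ[ℝ] E) (x : B) : Prop := ∃ y : Y, j y = ι x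

/-- The norm in `Y` of an element `x` of `B`; it is `∞` if `x` does not belong to `Y`. -/
noncomputable def normIn (ι : B →ₗ[ℝ] E) (j : Y →ₗ[ℝ] E) (x : B) : ℝ≥0∞ :=
  ⨅ (y : Y) (_ : j y = ι x), ‖y‖ₑ

/-- If `j` is injective and `x` is the element `y` of `Y`, then `normIn` is the norm of `y`. -/
theorem normIn_eq (ι : B →ₗ[ℝ] E) (j : Y →ₗ[ℝ] E) (hj : Function.Injective j) {x : B} {y : Y}
    (h : j y = ι x) : normIn ι j x = ‖y‖ₑ := by
  refine le_antisymm (iInf₂_le y h) (le_iInf₂ fun z hz => ?_)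
  rw [hj (hz.trans h.symm)]

/-- `u ∈ L^p(0,T; M ∩ Y)`: `u` is strongly measurable in `B` and in `Y`, takes values in `M ∩ Y`
almost everywhere on `(0,T)`, and `t ↦ [u(t)]` belongs to `L^p(0,T)`.
(Integrability of the norm of `u` in `Y` is not demanded.) -/
structure MemLpCone (M : SeminormedCone B) (ι : B →ₗ[ℝ] E) (j : Y →ₗ[ℝ] E)
    (p : ℝ≥0∞) (T : ℝ) (u : ℝ → B) : Prop where
  aestronglyMeasurable : AEStronglyMeasurable u (volume.restrict (Ioo 0 T))
  mem_cone : ∀ᵐ t ∂(volume.restrict (Ioo 0 T)), u t ∈ M.carrier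
  memLp_semi : MemLp (fun t => M.semi (u t)) p (volume.restrict (Ioo 0 T))
  measurable_in : ∃ v : ℝ → Y, AEStronglyMeasurable v (volume.restrict (Ioo 0 T)) ∧
    ∀ᵐ t ∂(volume.restrict (Ioo 0 T)), j (v t) = ι (u t)

/-- `‖σ_h u - u‖` in `L^p(0,T-h; Y)`, where `(σ_h u)(t) = u(t+h)`. -/
noncomputable def shiftNorm (ι : B →ₗ[ℝ] E) (j : Y →ₗ[ℝ] E) (p : ℝ≥0∞) (T : ℝ) (u : ℝ → B)
    (h : ℝ) : ℝ≥0∞ :=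
  eLpNorm (fun t => normIn ι j (u (t + h) - u t)) p (volume.restrict (Ioo 0 (T - h)))

end

/-- Compatibility along the sequence of pairs `(M (ν k), Y (ν k))`: if `w k` are differences of
elements of `M (ν k) ∩ Y (ν k)`, `w k → w` in `B`, and the norms of `w k` in `Y (ν k)` tend to
zero, then `w = 0`. -/
def CompatibleAlong (M : ℕ → SeminormedCone B) {Y : ℕ → Type*}
    [∀ n, NormedAddCommGroup (Y n)] [∀ n, NormedSpace ℝ (Y n)]
    (ι : B →ₗ[ℝ] E) (j : ∀ n, Y n →ₗ[ℝ] E) (ν : ℕ → ℕ) : Prop :=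
  ∀ (x y : ℕ → B) (w : B),
    (∀ k, x k ∈ (M (ν k)).carrier ∧ InSpace ι (j (ν k)) (x k)) →
    (∀ k, y k ∈ (M (ν k)).carrier ∧ InSpace ι (j (ν k)) (y k)) →
    Tendsto (fun k => x k - y k) atTop (𝓝 w) →
    Tendsto (fun k => normIn ι (j (ν k)) (x k - y k)) atTop (𝓝 0) → w = 0

end

/-!
By contradiction and compactness, hypotheses (a) and (b) yield Ehrling's inequality
`‖x - y‖_B ≤ ε ([x]_n + [y]_n) + L ‖x - y‖_{Y_n}` on `M_n ∩ Y_n`, with `L` independent of `n` for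
all large `n`. Hence the translates `u_n(· + h) - u_n` are small in `L^p(0,T-h; B)`, uniformly in
large `n`.

Cut `(0,T)` into finitely many short cells. By Fubini, the smallness of the translates bounds the
oscillation of `u_n` inside the cells, so that `u_n` is close in `L^p` to a step function taking on
each cell a value `u_n(s)` with `[u_n(s)]_n` bounded independently of `n`. By (a) these step
functions form a relatively compact set, and the range of `u` is totally bounded.

For `p = ∞`, the translates of a single `u_n` tend to zero in the essential supremum, so `u_n` is
uniformly continuous on a set of full measure and extends continuously to `[0,T]`; the supremum
distance of two continuous representatives is their distance in `L^∞`.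
-/

/-! ### Ehrling's inequality for cones -/

section

variable {B : Type*} [NormedAddCommGroup B] [NormedSpace ℝ B]
  {E : Type*} [AddCommGroup E] [Module ℝ E]

namespace SeminormedCone

theorem zero_mem {M : SeminormedCone B} (h : M.carrier.Nonempty) : (0 : B) ∈ M.carrier := by
  obtain ⟨x, hx⟩ := h
  simpa only [zero_smul] using M.smul_mem x hx 0 le_rfl

theorem semi_zero {M : SeminormedCone B} (h : M.carrier.Nonempty) : M.semi 0 = 0 :=
  (M.semi_eq_zero_iff 0 (zero_mem h)).2 rfl

end SeminormedCone

theorem CompactAlong.comp_strictMono {M : ℕ → SeminormedCone B} (hM : CompactAlong M id)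
    (hne : ∀ n, (M n).carrier.Nonempty) {ν : ℕ → ℕ} (hν : StrictMono ν) : CompactAlong M ν := by
  classical
  rintro w hw ⟨C, hC⟩
  set w' : ℕ → B := Function.extend ν w 0
  have hw' : ∀ k, w' (ν k) = w k := hν.injective.extend_apply w 0
  have hw'0 : ∀ n, (¬ ∃ k, ν k = n) → w' n = 0 := Function.extend_apply' w _
  have hcompact : IsCompact (closure (range w')) := by
    refine hM w' (fun n => ?_) ⟨max C 0, fun n => ?_⟩ <;> by_cases hn : ∃ k, ν k = n
    · obtain ⟨k, rfl⟩ := hn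
      exact (hw' k).symm ▸ hw k
    · exact (hw'0 n hn).symm ▸ SeminormedCone.zero_mem (hne n)
    · obtain ⟨k, rfl⟩ := hn
      exact (hw' k).symm ▸ le_max_of_le_left (hC k)
    · exact (hw'0 n hn).symm ▸ le_max_of_le_right (SeminormedCone.semi_zero (hne n)).le
  refine hcompact.of_isClosed_subset isClosed_closure (closure_mono ?_)
  rintro _ ⟨k, rfl⟩
  exact ⟨ν k, hw' k⟩

theorem CompactAlong.exists_subseq_tendsto_sub {M : ℕ → SeminormedCone B} {ν : ℕ → ℕ}
    (hM : CompactAlong M ν) {x y : ℕ → B} {C : ℝ}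
    (hx : ∀ k, x k ∈ (M (ν k)).carrier) (hxC : ∀ k, (M (ν k)).semi (x k) ≤ C)
    (hy : ∀ k, y k ∈ (M (ν k)).carrier) (hyC : ∀ k, (M (ν k)).semi (y k) ≤ C) :
    ∃ φ : ℕ → ℕ, StrictMono φ ∧ ∃ w, Tendsto (fun k => x (φ k) - y (φ k)) atTop (𝓝 w) := by
  obtain ⟨a, -, φ, hφ, hlimx⟩ :=
    (hM x hx ⟨C, hxC⟩).tendsto_subseq fun k => subset_closure (mem_range_self k)
  obtain ⟨b, -, ψ, hψ, hlimy⟩ :=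
    (hM y hy ⟨C, hyC⟩).tendsto_subseq fun k => subset_closure (mem_range_self (φ k))
  exact ⟨φ ∘ ψ, hφ.comp hψ, a - b, (hlimx.comp hψ.tendsto_atTop).sub hlimy⟩

section

variable {Y : Type*} [NormedAddCommGroup Y] [NormedSpace ℝ Y]

theorem InSpace.smul {ι : B →ₗ[ℝ] E} {j : Y →ₗ[ℝ] E} {x : B} (hx : InSpace ι j x) (c : ℝ) :
    InSpace ι j (c • x) := by
  obtain ⟨y, hy⟩ := hx
  exact ⟨c • y, by rw [map_smul, map_smul, hy]⟩

theorem normIn_smul_le (ι : B →ₗ[ℝ] E) (j : Y →ₗ[ℝ] E) {c : ℝ} (hc : c ≠ 0) (x : B) :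
    normIn ι j (c • x) ≤ ‖c‖ₑ * normIn ι j x := by
  simp only [normIn, ENNReal.mul_iInf_of_ne (enorm_ne_zero.2 hc) enorm_ne_top]
  refine le_iInf₂ fun y hy => iInf₂_le_of_le (c • y) ?_ (enorm_smul c y).le
  rw [map_smul, map_smul, hy]

theorem normIn_eq_infEDist_ker (ι : B →ₗ[ℝ] E) (j : Y →ₗ[ℝ] E) {x : B} {y : Y}
    (h : j y = ι x) : normIn ι j x = Metric.infEDist y (LinearMap.ker j) := by
  refine le_antisymm (le_iInf₂ fun k hk => ?_) (le_iInf₂ fun z hz => ?_)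
  · rw [edist_eq_enorm_sub]
    exact iInf₂_le _ (by rw [map_sub, LinearMap.mem_ker.1 hk, sub_zero, h])
  · refine (Metric.infEDist_le_edist_of_mem (y := y - z) ?_).trans_eq ?_
    · rw [SetLike.mem_coe, LinearMap.mem_ker, map_sub, h, hz, sub_self]
    · rw [edist_eq_enorm_sub, sub_sub_cancel]

/-- Ehrling's inequality for differences of elements of `M ∩ Y`. It replaces the interpolation
inequality between three nested spaces when `M` is not a linear space. -/
def EhrlingWith (M : SeminormedCone B) (ι : B →ₗ[ℝ] E) (j : Y →ₗ[ℝ] E) (ε L : ℝ≥0) : Prop :=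
  ∀ x ∈ M.carrier, ∀ y ∈ M.carrier, InSpace ι j x → InSpace ι j y →
    ‖x - y‖ₑ ≤ ε * (‖M.semi x‖ₑ + ‖M.semi y‖ₑ) + L * normIn ι j (x - y)

theorem exists_normalized_of_not_ehrlingWith {M : SeminormedCone B} {ι : B →ₗ[ℝ] E}
    {j : Y →ₗ[ℝ] E} {ε L : ℝ≥0} (h : ¬ EhrlingWith M ι j ε L) :
    ∃ x y : B, (x ∈ M.carrier ∧ InSpace ι j x) ∧ (y ∈ M.carrier ∧ InSpace ι j y) ∧
      M.semi x ≤ 1 ∧ M.semi y ≤ 1 ∧ ε ≤ ‖x - y‖ₑ ∧ L * normIn ι j (x - y) ≤ ‖x - y‖ₑ := by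
  simp only [EhrlingWith, not_forall, not_le] at h
  obtain ⟨x, hx, y, hy, hxY, hyY, hlt⟩ := h
  have hx0 := M.semi_nonneg x hx
  have hy0 := M.semi_nonneg y hy
  set S := M.semi x + M.semi y with hS
  have hS0 : S ≠ 0 := by
    intro h0
    obtain ⟨hx', hy'⟩ := (add_eq_zero_iff_of_nonneg hx0 hy0).1 h0
    rw [(M.semi_eq_zero_iff x hx).1 hx', (M.semi_eq_zero_iff y hy).1 hy', sub_self,
      enorm_zero] at hlt
    exact not_lt_zero hlt
  have hSpos : 0 < S := lt_of_le_of_ne (by positivity) hS0.symm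
  have hinv : 0 ≤ S⁻¹ := (inv_pos.2 hSpos).le
  have henorm : ‖M.semi x‖ₑ + ‖M.semi y‖ₑ = ‖S‖ₑ := by
    rw [Real.enorm_of_nonneg hx0, Real.enorm_of_nonneg hy0, Real.enorm_of_nonneg hSpos.le,
      ENNReal.ofReal_add hx0 hy0]
  rw [henorm] at hlt
  have hscale : ‖S⁻¹‖ₑ * ‖S‖ₑ = 1 := by rw [← enorm_mul, inv_mul_cancel₀ hS0, enorm_one]
  have hnorm : ‖S⁻¹ • x - S⁻¹ • y‖ₑ = ‖S⁻¹‖ₑ * ‖x - y‖ₑ := by rw [← smul_sub, enorm_smul]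
  refine ⟨S⁻¹ • x, S⁻¹ • y, ⟨M.smul_mem x hx _ hinv, hxY.smul _⟩,
    ⟨M.smul_mem y hy _ hinv, hyY.smul _⟩, ?_, ?_, ?_, ?_⟩
  · rw [M.semi_smul x hx _ hinv, inv_mul_le_one₀ hSpos]
    exact le_add_of_nonneg_right hy0
  · rw [M.semi_smul y hy _ hinv, inv_mul_le_one₀ hSpos]
    exact le_add_of_nonneg_left hx0
  · calc (ε : ℝ≥0∞) = ‖S⁻¹‖ₑ * (ε * ‖S‖ₑ) := by rw [mul_left_comm, hscale, mul_one]
      _ ≤ _ := hnorm ▸ mul_le_mul_right (le_self_add.trans hlt.le) _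
  · calc L * normIn ι j (S⁻¹ • x - S⁻¹ • y) ≤ L * (‖S⁻¹‖ₑ * normIn ι j (x - y)) := by
          rw [← smul_sub]
          exact mul_le_mul_right (normIn_smul_le ι j (inv_ne_zero hS0) _) _
      _ = ‖S⁻¹‖ₑ * (L * normIn ι j (x - y)) := mul_left_comm _ _ _
      _ ≤ _ := hnorm ▸ mul_le_mul_right (le_add_self.trans hlt.le) _

end

section

variable {Y : ℕ → Type*} [∀ n, NormedAddCommGroup (Y n)] [∀ n, NormedSpace ℝ (Y n)]
  {M : ℕ → SeminormedCone B} {ι : B →ₗ[ℝ] E} {j : ∀ n, Y n →ₗ[ℝ] E} {ε : ℝ≥0}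

theorem exists_ehrlingWith_along {ν : ℕ → ℕ} (hM : CompactAlong M ν)
    (hY : ∀ φ : ℕ → ℕ, StrictMono φ → CompatibleAlong M ι j (ν ∘ φ)) (hε : ε ≠ 0) :
    ∃ k : ℕ, EhrlingWith (M (ν k)) ι (j (ν k)) ε k := by
  by_contra! hcon
  choose x y hx hy hx1 hy1 hxy hL using fun k => exists_normalized_of_not_ehrlingWith (hcon k)
  obtain ⟨φ, hφ, w, hw⟩ := hM.exists_subseq_tendsto_sub (fun k => (hx k).1) hx1
    (fun k => (hy k).1) hy1
  have hnormIn : Tendsto (fun k => normIn ι (j (ν (φ k))) (x (φ k) - y (φ k))) atTop (𝓝 0) := by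
    have hquot : Tendsto (fun k => ‖x (φ k) - y (φ k)‖ₑ / (φ k : ℝ≥0∞)) atTop (𝓝 0) := by
      simpa using ENNReal.Tendsto.div hw.enorm (Or.inr ENNReal.top_ne_zero)
        (ENNReal.tendsto_nat_nhds_top.comp hφ.tendsto_atTop) (Or.inr enorm_ne_top)
    refine tendsto_of_tendsto_of_tendsto_of_le_of_le' tendsto_const_nhds hquot
      (Eventually.of_forall fun _ => zero_le) ?_
    filter_upwards [hφ.tendsto_atTop.eventually_gt_atTop 0] with k hk
    rw [ENNReal.le_div_iff_mul_le (Or.inl (by exact_mod_cast hk.ne'))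
      (Or.inl (ENNReal.natCast_ne_top _)), mul_comm]
    exact_mod_cast hL (φ k)
  obtain rfl := hY φ hφ (x ∘ φ) (y ∘ φ) w (fun k => hx _) (fun k => hy _) hw hnormIn
  have hle : (ε : ℝ≥0∞) ≤ ‖(0 : B)‖ₑ := ge_of_tendsto' hw.enorm fun k => hxy (φ k)
  exact hε (by simpa using hle)

theorem exists_eventually_ehrlingWith (hM : ∀ ν : ℕ → ℕ, StrictMono ν → CompactAlong M ν)
    (hY : ∀ ν : ℕ → ℕ, StrictMono ν → CompatibleAlong M ι j ν) (hε : ε ≠ 0) :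
    ∃ L : ℝ≥0, ∀ᶠ n in atTop, EhrlingWith (M n) ι (j n) ε L := by
  by_contra! hcon
  obtain ⟨ν, hν, h⟩ := extraction_forall_of_frequently
    (P := fun k n => ¬ EhrlingWith (M n) ι (j n) ε k) fun k => hcon k
  obtain ⟨k, hk⟩ := exists_ehrlingWith_along (hM ν hν) (fun φ hφ => hY _ (hν.comp hφ)) hε
  exact h k hk

end

end

/-! ### Sampling on the cells of a partition -/

/-- The `L^p` norm of `u y - u x` over the pairs `(x, y)` in a common cell of the partition of `X`
into the fibers of `c`. It bounds the error of replacing `u` on each cell by a suitable sample. -/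
noncomputable def fiberOscillation {X κ F : Type*} [MeasurableSpace X] [NormedAddCommGroup F]
    (c : X → κ) (u : X → F) (p : ℝ≥0∞) (μ : Measure X) : ℝ≥0∞ :=
  eLpNorm (fun z : X × X => u z.2 - u z.1) p ((μ.prod μ).restrict {z | c z.1 = c z.2})

section

variable {X κ : Type*} [MeasurableSpace X] {μ : Measure X} [Fintype κ] [MeasurableSpace κ]
  [MeasurableSingletonClass κ] {c : X → κ}

theorem sum_setLIntegral_fiber (hc : Measurable c) (f : X → ℝ≥0∞) :
    ∑ k, ∫⁻ x in c ⁻¹' {k}, f x ∂μ = ∫⁻ x, f x ∂μ := by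
  rw [← tsum_fintype (L := .unconditional _), ← lintegral_iUnion
    (fun k => hc (measurableSet_singleton k)) (pairwise_disjoint_fiber c),
    ← preimage_iUnion, iUnion_singleton_eq_range]
  simp

variable [IsFiniteMeasure μ] {m : ℝ≥0∞} {P : X → Prop}

theorem exists_section_mul_sum_le_lintegral (hc : Measurable c) (hm : m ≠ 0)
    (hcm : ∀ k, m ≤ μ (c ⁻¹' {k})) (hP : ∀ᵐ x ∂μ, P x) {F : X → ℝ≥0∞}
    (hF : AEMeasurable F μ) :
    ∃ s : κ → X, (∀ k, c (s k) = k ∧ P (s k)) ∧ m * ∑ k, F (s k) ≤ ∫⁻ x, F x ∂μ := by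
  have hex : ∀ k, ∃ x, (c x = k ∧ P x) ∧ m * F x ≤ ∫⁻ x in c ⁻¹' {k}, F x ∂μ := by
    intro k
    have hne : μ.restrict (c ⁻¹' {k}) ≠ 0 := by
      rw [Ne, Measure.restrict_eq_zero]
      exact fun h => hm (le_zero_iff.1 (h ▸ hcm k))
    have hnull : ∀ᵐ x ∂μ.restrict (c ⁻¹' {k}), c x = k ∧ P x :=
      (ae_restrict_mem (hc (measurableSet_singleton k))).and (ae_restrict_of_ae hP)
    obtain ⟨x, hx, hle⟩ := exists_notMem_null_le_laverage hne hF.restrict hnull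
    refine ⟨x, not_not.1 hx, ?_⟩
    calc m * F x ≤ μ (c ⁻¹' {k}) * ⨍⁻ x in c ⁻¹' {k}, F x ∂μ := mul_le_mul' (hcm k) hle
      _ = _ := measure_mul_setLAverage _ (measure_ne_top μ _)
  choose s hs hle using hex
  refine ⟨s, hs, ?_⟩
  rw [Finset.mul_sum, ← sum_setLIntegral_fiber hc]
  exact Finset.sum_le_sum fun k _ => hle k

theorem exists_section_mul_sum_le_two_mul_lintegral (hc : Measurable c) (hm : m ≠ 0)
    (hcm : ∀ k, m ≤ μ (c ⁻¹' {k})) (hP : ∀ᵐ x ∂μ, P x) {F G : X → ℝ≥0∞}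
    (hF : AEMeasurable F μ) (hG : AEMeasurable G μ) :
    ∃ s : κ → X, (∀ k, c (s k) = k ∧ P (s k)) ∧
      m * ∑ k, F (s k) ≤ 2 * ∫⁻ x, F x ∂μ ∧ m * ∑ k, G (s k) ≤ 2 * ∫⁻ x, G x ∂μ := by
  -- The integral of `F / ∫ F + G / ∫ G` is at most `2`, so one section serves both functions.
  set a := ∫⁻ x, F x ∂μ
  set b := ∫⁻ x, G x ∂μ
  obtain ⟨s, hs, hle⟩ := exists_section_mul_sum_le_lintegral hc hm hcm hP
    ((hF.mul_const a⁻¹).add (hG.mul_const b⁻¹))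
  have htotal : ∫⁻ x, (F x * a⁻¹ + G x * b⁻¹) ∂μ ≤ 2 := by
    rw [lintegral_add_left' (hF.mul_const a⁻¹), lintegral_mul_const'' _ hF,
      lintegral_mul_const'' _ hG, ← one_add_one_eq_two]
    exact add_le_add (ENNReal.mul_inv_le_one _) (ENNReal.mul_inv_le_one _)
  replace hle : m * (∑ k, F (s k)) / a + m * (∑ k, G (s k)) / b ≤ 2 := by
    simpa only [Pi.add_apply, Finset.sum_add_distrib, mul_add, ← Finset.sum_mul, div_eq_mul_inv,
      mul_assoc] using hle.trans htotal
  refine ⟨s, hs, ?_, ?_⟩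
  · exact (ENNReal.div_le_iff_le_mul (Or.inr ENNReal.ofNat_ne_top) (Or.inr two_ne_zero)).1
      (le_self_add.trans hle)
  · exact (ENNReal.div_le_iff_le_mul (Or.inr ENNReal.ofNat_ne_top) (Or.inr two_ne_zero)).1
      (le_add_self.trans hle)

end

section

variable {X κ F : Type*} [MeasurableSpace X] {μ : Measure X} [MeasurableSpace κ]
  [MeasurableSingletonClass κ] [NormedAddCommGroup F] {c : X → κ}

section

variable [Countable κ]

theorem measurableSet_setOf_fiber_eq (hc : Measurable c) :
    MeasurableSet {z : X × X | c z.1 = c z.2} :=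
  measurableSet_eq_fun (hc.comp measurable_fst) (hc.comp measurable_snd)

theorem exists_section_ae_enorm_sub_le [SFinite μ] {P : X → Prop} {u : X → F} (hc : Measurable c)
    (hc0 : ∀ k, μ (c ⁻¹' {k}) ≠ 0) (hP : ∀ᵐ x ∂μ, P x) {ω : ℝ≥0∞}
    (hω : ∀ᵐ z ∂(μ.prod μ).restrict {z | c z.1 = c z.2}, ‖u z.2 - u z.1‖ₑ ≤ ω) :
    ∃ s : κ → X, (∀ k, P (s k)) ∧ ∀ᵐ t ∂μ, ‖u t - u (s (c t))‖ₑ ≤ ω := by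
  have hω' : ∀ᵐ x ∂μ, ∀ᵐ t ∂μ, c x = c t → ‖u t - u x‖ₑ ≤ ω :=
    Measure.ae_ae_of_ae_prod ((ae_restrict_iff' (measurableSet_setOf_fiber_eq hc)).1 hω)
  have hex : ∀ k, ∃ x, c x = k ∧ P x ∧ ∀ᵐ t ∂μ, c x = c t → ‖u t - u x‖ₑ ≤ ω := by
    intro k
    have : (ae (μ.restrict (c ⁻¹' {k}))).NeBot := ae_restrict_neBot.2 (hc0 k)
    exact ((ae_restrict_mem (hc (measurableSet_singleton k))).and
      (ae_restrict_of_ae (hP.and hω'))).exists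
  choose s hcs hPs hs using hex
  refine ⟨s, hPs, ?_⟩
  filter_upwards [ae_all_iff.2 hs] with t ht
  exact ht (c t) (hcs _)

end

variable {G : Type*} [NormedAddCommGroup G] [Finite κ] [IsFiniteMeasure μ] {P : X → Prop}
  {u : X → F} {q : X → G}

theorem exists_section_lintegral_rpow_enorm_sub_le {m : ℝ≥0∞} (hc : Measurable c) (hm : m ≠ 0)
    (hcm : ∀ k, m ≤ μ (c ⁻¹' {k})) (hP : ∀ᵐ x ∂μ, P x) (hu : AEStronglyMeasurable u μ)
    (hq : AEStronglyMeasurable q μ) (e : ℝ) :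
    ∃ s : κ → X, (∀ k, P (s k)) ∧
      (∀ k, m * ‖q (s k)‖ₑ ^ e ≤ 2 * ∫⁻ x, ‖q x‖ₑ ^ e ∂μ) ∧
      m * ∫⁻ t, ‖u t - u (s (c t))‖ₑ ^ e ∂μ ≤
        2 * ∫⁻ z in {z | c z.1 = c z.2}, ‖u z.2 - u z.1‖ₑ ^ e ∂μ.prod μ := by
  have := Fintype.ofFinite κ
  set D : Set (X × X) := {z | c z.1 = c z.2} with hD
  have hDm : MeasurableSet D := measurableSet_setOf_fiber_eq hc
  set f : X × X → ℝ≥0∞ := D.indicator fun z => ‖u z.2 - u z.1‖ₑ ^ e with hf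
  have hfm : AEMeasurable f (μ.prod μ) :=
    ((hu.comp_snd.sub hu.comp_fst).enorm.pow_const e).indicator hDm
  obtain ⟨s, hs, hq', hu'⟩ := exists_section_mul_sum_le_two_mul_lintegral hc hm hcm hP
    (hq.enorm.pow_const e) hfm.lintegral_prod_right'
  have hfiber : ∀ k, ∫⁻ t in c ⁻¹' {k}, ‖u t - u (s (c t))‖ₑ ^ e ∂μ = ∫⁻ t, f (s k, t) ∂μ := by
    intro k
    rw [← lintegral_indicator (hc (measurableSet_singleton k))]
    refine lintegral_congr fun t => ?_
    by_cases ht : c t = k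
    · simp [hf, hD, (hs k).1, ht]
    · simp [hf, hD, (hs k).1, ht, Ne.symm ht]
  refine ⟨s, fun k => (hs k).2, fun k => ?_, ?_⟩
  · exact (mul_le_mul_right (Finset.single_le_sum (fun _ _ => zero_le) (Finset.mem_univ k))
      m).trans hq'
  · rwa [← sum_setLIntegral_fiber hc, Finset.sum_congr rfl fun k _ => hfiber k,
      ← lintegral_indicator hDm, lintegral_prod f hfm]

/-- At `p = ∞` the exponent `1 / p.toReal` is `1 / 0 = 0`, so both factors are `1`. -/
theorem exists_section_eLpNorm_sub_le {m : ℝ≥0} (hc : Measurable c) (hm : m ≠ 0)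
    (hcm : ∀ k, m ≤ μ (c ⁻¹' {k})) (hP : ∀ᵐ x ∂μ, P x) (hu : AEStronglyMeasurable u μ)
    (hq : AEStronglyMeasurable q μ) {p : ℝ≥0∞} (hp : p ≠ 0) :
    ∃ s : κ → X,
      (∀ k, P (s k) ∧ ‖q (s k)‖ₑ ≤ (2 / m : ℝ≥0∞) ^ (1 / p.toReal) * eLpNorm q p μ) ∧
      eLpNorm (fun t => u t - u (s (c t))) p μ ≤
        (2 / m : ℝ≥0∞) ^ (1 / p.toReal) * fiberOscillation c u p μ := by
  rcases eq_or_ne p ∞ with rfl | hp'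
  · obtain ⟨s, hs, hle⟩ := exists_section_ae_enorm_sub_le hc
      (fun k h => hm (by simpa [h] using hcm k)) (hP.and (ae_le_eLpNormEssSup (f := q)))
      (ae_le_eLpNormEssSup (f := fun z : X × X => u z.2 - u z.1))
    simp only [ENNReal.toReal_top, div_zero, ENNReal.rpow_zero, one_mul, fiberOscillation,
      eLpNorm_exponent_top]
    exact ⟨s, hs, essSup_le_of_ae_le _ hle⟩
  · have he : 0 < p.toReal := ENNReal.toReal_pos hp hp'
    have hm' : (m : ℝ≥0∞) ≠ 0 := ENNReal.coe_ne_zero.2 hm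
    obtain ⟨s, hs, hqs, hus⟩ :=
      exists_section_lintegral_rpow_enorm_sub_le hc hm' hcm hP hu hq p.toReal
    have hroot : ∀ {a b : ℝ≥0∞}, m * a ≤ 2 * b →
        a ^ (1 / p.toReal) ≤ (2 / m : ℝ≥0∞) ^ (1 / p.toReal) * b ^ (1 / p.toReal) := by
      intro a b hab
      rw [← ENNReal.mul_rpow_of_nonneg _ _ (by positivity)]
      gcongr
      rwa [← ENNReal.mul_div_right_comm,
        ENNReal.le_div_iff_mul_le (Or.inl hm') (Or.inl ENNReal.coe_ne_top), mul_comm a]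
    simp only [fiberOscillation, eLpNorm_eq_lintegral_rpow_enorm_toReal hp hp']
    refine ⟨s, fun k => ⟨hs k, ?_⟩, hroot hus⟩
    simpa [he.ne'] using hroot (hqs k)

end

/-! ### Translates and the oscillation near the diagonal -/

section

theorem lintegral_prod_eq_lintegral_shear {g : ℝ × ℝ → ℝ≥0∞}
    (hg : AEMeasurable g (volume.prod volume)) :
    ∫⁻ z, g z ∂volume.prod volume = ∫⁻ r, ∫⁻ s, g (s, s + r) := by
  have hshear := measurePreserving_prod_add (volume : Measure ℝ) (volume : Measure ℝ)
  calc ∫⁻ z, g z ∂volume.prod volume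
      = ∫⁻ z : ℝ × ℝ, g (z.1, z.1 + z.2) ∂volume.prod volume := by
        conv_lhs => rw [← hshear.map_eq]
        exact lintegral_map' (by rwa [hshear.map_eq]) hshear.aemeasurable
    _ = ∫⁻ r, ∫⁻ s, g (s, s + r) :=
        lintegral_prod_symm _ (hg.comp_quasiMeasurePreserving hshear.quasiMeasurePreserving)

variable {T h : ℝ} {ω : ℝ≥0∞}

theorem lintegral_upperDiagonal_le {f : ℝ × ℝ → ℝ≥0∞}
    (hf : AEMeasurable f ((volume.restrict (Ioo 0 T)).prod (volume.restrict (Ioo 0 T))))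
    (hω : ∀ r ∈ Ico 0 h, ∫⁻ s in Ioo 0 (T - r), f (s, s + r) ≤ ω) :
    ∫⁻ z in {z : ℝ × ℝ | z.1 ≤ z.2 ∧ z.2 < z.1 + h}, f z
      ∂(volume.restrict (Ioo 0 T)).prod (volume.restrict (Ioo 0 T)) ≤ ENNReal.ofReal h * ω := by
  set D : Set (ℝ × ℝ) := {z | z.1 ≤ z.2 ∧ z.2 < z.1 + h} with hD
  have hDm : MeasurableSet D := (measurableSet_le measurable_fst measurable_snd).inter
    (measurableSet_lt measurable_snd (measurable_fst.add_const h))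
  have hSm : MeasurableSet (D ∩ Ioo 0 T ×ˢ Ioo 0 T) :=
    hDm.inter (measurableSet_Ioo.prod measurableSet_Ioo)
  set g := (D ∩ Ioo 0 T ×ˢ Ioo 0 T).indicator f
  rw [Measure.prod_restrict] at hf ⊢
  rw [Measure.restrict_restrict hDm]
  have hgm : AEMeasurable g (volume.prod volume) :=
    (aemeasurable_indicator_iff hSm).2
      (hf.mono_measure (Measure.restrict_mono inter_subset_right le_rfl))
  have hslice : ∀ r, ∫⁻ s, g (s, s + r) ≤ (Ico 0 h).indicator (fun _ => ω) r := by
    intro r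
    have hmem : ∀ s, (s, s + r) ∈ D ∩ Ioo 0 T ×ˢ Ioo 0 T → r ∈ Ico 0 h ∧ s ∈ Ioo 0 (T - r) := by
      rintro s ⟨⟨h1, h2⟩, h3, h4⟩
      simp only [mem_Ioo, mem_Ico] at *
      exact ⟨⟨by linarith, by linarith⟩, by linarith, by linarith⟩
    by_cases hr : r ∈ Ico 0 h
    · rw [indicator_of_mem hr]
      have hle : ∀ s, g (s, s + r) ≤ (Ioo 0 (T - r)).indicator (fun s => f (s, s + r)) s := by
        intro s
        refine indicator_apply_le' (fun hs => ?_) fun _ => zero_le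
        rw [indicator_of_mem (hmem s hs).2]
      exact (lintegral_mono hle).trans
        ((lintegral_indicator measurableSet_Ioo _).trans_le (hω r hr))
    · rw [indicator_of_notMem hr, nonpos_iff_eq_zero]
      exact (lintegral_congr fun s => indicator_of_notMem (fun hs => hr (hmem s hs).1) f).trans
        lintegral_zero
  calc ∫⁻ z in D ∩ Ioo 0 T ×ˢ Ioo 0 T, f z ∂volume.prod volume
      = ∫⁻ z, g z ∂volume.prod volume := (lintegral_indicator hSm f).symm
    _ = ∫⁻ r, ∫⁻ s, g (s, s + r) := lintegral_prod_eq_lintegral_shear hgm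
    _ ≤ ∫⁻ r, (Ico 0 h).indicator (fun _ => ω) r := lintegral_mono hslice
    _ = ENNReal.ofReal h * ω := by
      rw [lintegral_indicator measurableSet_Ico, setLIntegral_const, Real.volume_Ico, sub_zero,
        mul_comm]

theorem lintegral_nearDiagonal_le {f : ℝ × ℝ → ℝ≥0∞}
    (hf : AEMeasurable f ((volume.restrict (Ioo 0 T)).prod (volume.restrict (Ioo 0 T))))
    (hsymm : ∀ z, f z.swap = f z)
    (hω : ∀ r ∈ Ico 0 h, ∫⁻ s in Ioo 0 (T - r), f (s, s + r) ≤ ω) :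
    ∫⁻ z in {z : ℝ × ℝ | dist z.1 z.2 < h}, f z
      ∂(volume.restrict (Ioo 0 T)).prod (volume.restrict (Ioo 0 T)) ≤
      ENNReal.ofReal (2 * h) * ω := by
  set μ := (volume.restrict (Ioo (0 : ℝ) T)).prod (volume.restrict (Ioo 0 T))
  set D : Set (ℝ × ℝ) := {z | z.1 ≤ z.2 ∧ z.2 < z.1 + h}
  have hD := lintegral_upperDiagonal_le hf hω
  have hswap : ∫⁻ z in Prod.swap ⁻¹' D, f z ∂μ = ∫⁻ z in D, f z ∂μ := by
    rw [← Measure.measurePreserving_swap.setLIntegral_comp_preimage_emb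
      MeasurableEquiv.prodComm.measurableEmbedding f D]
    exact lintegral_congr fun z => (hsymm z).symm
  have hcover : {z : ℝ × ℝ | dist z.1 z.2 < h} ⊆ D ∪ Prod.swap ⁻¹' D := by
    rintro ⟨s, t⟩ hz
    simp only [D, mem_union, mem_preimage, mem_ofPred_eq, Prod.swap, Real.dist_eq, abs_lt] at hz ⊢
    rcases le_total s t with h | h
    · exact Or.inl ⟨h, by linarith⟩
    · exact Or.inr ⟨h, by linarith⟩
  calc _ ≤ ∫⁻ z in D ∪ Prod.swap ⁻¹' D, f z ∂μ := lintegral_mono_set hcover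
    _ ≤ ∫⁻ z in D, f z ∂μ + ∫⁻ z in Prod.swap ⁻¹' D, f z ∂μ := lintegral_union_le ..
    _ ≤ ENNReal.ofReal h * ω + ENNReal.ofReal h * ω := add_le_add hD (hswap.trans_le hD)
    _ = ENNReal.ofReal (2 * h) * ω := by
      rw [ENNReal.ofReal_mul zero_le_two, ENNReal.ofReal_ofNat, ← two_mul, mul_assoc]

variable {F : Type*} [NormedAddCommGroup F] {u : ℝ → F}

theorem eLpNorm_sub_nearDiagonal_le (hu : AEStronglyMeasurable u (volume.restrict (Ioo 0 T)))
    {p : ℝ≥0∞} (hp : p ≠ 0) (hω : ∀ r ∈ Ioo 0 h,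
      eLpNorm (fun t => u (t + r) - u t) p (volume.restrict (Ioo 0 (T - r))) ≤ ω) :
    eLpNorm (fun z : ℝ × ℝ => u z.2 - u z.1) p
      (((volume.restrict (Ioo 0 T)).prod (volume.restrict (Ioo 0 T))).restrict
        {z | dist z.1 z.2 < h}) ≤ ENNReal.ofReal (2 * h) ^ (1 / p.toReal) * ω := by
  have hω' : ∀ r ∈ Ico 0 h,
      eLpNorm (fun t => u (t + r) - u t) p (volume.restrict (Ioo 0 (T - r))) ≤ ω := by
    intro r hr
    rcases hr.1.eq_or_lt with rfl | hr0
    · simp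
    · exact hω r ⟨hr0, hr.2⟩
  have hum := (hu.comp_snd (μ := volume.restrict (Ioo 0 T))).sub
    (hu.comp_fst (ν := volume.restrict (Ioo 0 T)))
  rcases eq_or_ne p ∞ with rfl | hp'
  · simp only [eLpNorm_exponent_top, ENNReal.toReal_top, div_zero, ENNReal.rpow_zero,
      one_mul] at hω' ⊢
    have hfm := hum.enorm.sub_const ω
    have hzero := lintegral_nearDiagonal_le (h := h) (ω := 0) hfm
      (fun z => by simp only [Pi.sub_apply, Prod.fst_swap, Prod.snd_swap, enorm_sub_rev])
      fun r hr => le_of_eq <| lintegral_eq_zero_of_ae_eq_zero <| by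
        filter_upwards [ae_le_eLpNormEssSup (f := fun t => u (t + r) - u t)] with t ht
        exact tsub_eq_zero_of_le (ht.trans (hω' r hr))
    rw [mul_zero, nonpos_iff_eq_zero, lintegral_eq_zero_iff' hfm.restrict] at hzero
    refine essSup_le_of_ae_le _ ?_
    filter_upwards [hzero] with z hz using tsub_eq_zero_iff_le.1 hz
  · have he : 0 < p.toReal := ENNReal.toReal_pos hp hp'
    have hroot : ∀ {a b : ℝ≥0∞}, a ^ (1 / p.toReal) ≤ b ↔ a ≤ b ^ p.toReal := by
      intro a b
      rw [one_div, ENNReal.rpow_inv_le_iff he]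
    simp only [eLpNorm_eq_lintegral_rpow_enorm_toReal hp hp', hroot] at hω' ⊢
    rw [ENNReal.mul_rpow_of_nonneg _ _ he.le, ← ENNReal.rpow_mul, one_div_mul_cancel he.ne',
      ENNReal.rpow_one]
    exact lintegral_nearDiagonal_le (hum.enorm.pow_const _)
      (fun z => by simp only [Prod.fst_swap, Prod.snd_swap, enorm_sub_rev]) hω'

end

/-! ### Translates of cone-valued functions -/

section

variable {T h : ℝ}

theorem measurePreserving_add_right_Ioo (T h : ℝ) :
    MeasurePreserving (fun t : ℝ => t + h) (volume.restrict (Ioo 0 (T - h)))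
      (volume.restrict (Ioo h T)) := by
  have := (measurePreserving_add_right (volume : Measure ℝ) h).restrict_preimage
    (measurableSet_Ioo (a := h) (b := T))
  rwa [preimage_add_const_Ioo, sub_self] at this

theorem restrict_Ioo_sub_le (T : ℝ) (hh : 0 ≤ h) :
    (volume : Measure ℝ).restrict (Ioo 0 (T - h)) ≤ volume.restrict (Ioo 0 T) :=
  Measure.restrict_mono (Ioo_subset_Ioo_right (sub_le_self T hh)) le_rfl

theorem restrict_Ioo_le (T : ℝ) (hh : 0 ≤ h) :
    (volume : Measure ℝ).restrict (Ioo h T) ≤ volume.restrict (Ioo 0 T) :=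
  Measure.restrict_mono (Ioo_subset_Ioo_left hh) le_rfl

theorem ae_and_ae_add (hh : 0 ≤ h) {P : ℝ → Prop}
    (hP : ∀ᵐ t ∂(volume.restrict (Ioo 0 T)), P t) :
    ∀ᵐ t ∂(volume.restrict (Ioo 0 (T - h))), P t ∧ P (t + h) :=
  (hP.filter_mono (ae_mono (restrict_Ioo_sub_le T hh))).and
    ((measurePreserving_add_right_Ioo T h).quasiMeasurePreserving.ae
      (hP.filter_mono (ae_mono (restrict_Ioo_le T hh))))

variable {F : Type*} [NormedAddCommGroup F] {f : ℝ → F}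

theorem aestronglyMeasurable_add_Ioo (hh : 0 ≤ h)
    (hf : AEStronglyMeasurable f (volume.restrict (Ioo 0 T))) :
    AEStronglyMeasurable (fun t => f (t + h)) (volume.restrict (Ioo 0 (T - h))) :=
  (hf.mono_measure (restrict_Ioo_le T hh)).comp_measurePreserving
    (measurePreserving_add_right_Ioo T h)

theorem eLpNorm_add_Ioo_le (hh : 0 ≤ h) {p : ℝ≥0∞}
    (hf : AEStronglyMeasurable f (volume.restrict (Ioo 0 T))) :
    eLpNorm (fun t => f (t + h)) p (volume.restrict (Ioo 0 (T - h)))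
      ≤ eLpNorm f p (volume.restrict (Ioo 0 T)) :=
  (eLpNorm_comp_measurePreserving (hf.mono_measure (restrict_Ioo_le T hh))
    (measurePreserving_add_right_Ioo T h)).trans_le (eLpNorm_mono_measure _ (restrict_Ioo_le T hh))

theorem eLpNorm_enorm_add_enorm_shift_le (hh : 0 ≤ h) {p : ℝ≥0∞} (hp : 1 ≤ p)
    (hf : AEStronglyMeasurable f (volume.restrict (Ioo 0 T))) :
    eLpNorm (fun t => ‖f (t + h)‖ₑ + ‖f t‖ₑ) p (volume.restrict (Ioo 0 (T - h))) ≤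
      2 * eLpNorm f p (volume.restrict (Ioo 0 T)) := by
  have hsub := restrict_Ioo_sub_le T hh
  refine (eLpNorm_add_le
    (aestronglyMeasurable_add_Ioo hh hf).enorm.aestronglyMeasurable
    (hf.mono_measure hsub).enorm.aestronglyMeasurable hp).trans ?_
  rw [eLpNorm_enorm, eLpNorm_enorm, two_mul]
  exact add_le_add (eLpNorm_add_Ioo_le hh hf) (eLpNorm_mono_measure f hsub)

end

theorem eLpNorm_mul_add_mul_le {X : Type*} [MeasurableSpace X] {μ : Measure X}
    {f g : X → ℝ≥0∞} {p : ℝ≥0∞} (a b : ℝ≥0) (hf : AEMeasurable f μ) (hg : AEMeasurable g μ)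
    (hp : 1 ≤ p) :
    eLpNorm (fun x => a * f x + b * g x) p μ ≤ a * eLpNorm f p μ + b * eLpNorm g p μ := by
  have hmul : ∀ (c : ℝ≥0) (f : X → ℝ≥0∞), eLpNorm (fun x => c * f x) p μ ≤ c * eLpNorm f p μ :=
    fun c f => eLpNorm_le_nnreal_smul_eLpNorm_of_ae_le_mul' (.of_forall fun _ => le_rfl) p
  exact (eLpNorm_add_le (hf.const_mul _).aestronglyMeasurable
    (hg.const_mul _).aestronglyMeasurable hp).trans (add_le_add (hmul a f) (hmul b g))

section

variable {B : Type*} [NormedAddCommGroup B] [NormedSpace ℝ B]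
  {E : Type*} [AddCommGroup E] [Module ℝ E]

section

variable {Y : Type*} [NormedAddCommGroup Y] [NormedSpace ℝ Y]
  {M : SeminormedCone B} {ι : B →ₗ[ℝ] E} {j : Y →ₗ[ℝ] E} {p : ℝ≥0∞} {T : ℝ} {u : ℝ → B}

namespace MemLpCone

theorem memLp (hM : M.ContinuouslyEmbedded) (hu : MemLpCone M ι j p T u) :
    MemLp u p (volume.restrict (Ioo 0 T)) := by
  obtain ⟨C, -, hC⟩ := hM
  refine (hu.memLp_semi.const_mul C).mono hu.aestronglyMeasurable ?_
  filter_upwards [hu.mem_cone] with t ht using (hC _ ht).trans (le_abs_self _)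

theorem nonempty (hT : 0 < T) (hu : MemLpCone M ι j p T u) : M.carrier.Nonempty := by
  have : (ae (volume.restrict (Ioo 0 T))).NeBot := ae_restrict_neBot.2 (by simpa using hT)
  obtain ⟨t, ht⟩ := hu.mem_cone.exists
  exact ⟨u t, ht⟩

theorem aemeasurable_normIn_sub (hu : MemLpCone M ι j p T u) {h : ℝ} (hh : 0 ≤ h) :
    AEMeasurable (fun t => normIn ι j (u (t + h) - u t)) (volume.restrict (Ioo 0 (T - h))) := by
  obtain ⟨v, hv, hvu⟩ := hu.measurable_in
  have hdiff : AEStronglyMeasurable (fun t => v (t + h) - v t) (volume.restrict (Ioo 0 (T - h))) :=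
    (aestronglyMeasurable_add_Ioo hh hv).sub (hv.mono_measure (restrict_Ioo_sub_le T hh))
  refine ((Metric.continuous_infEDist (s := (LinearMap.ker j : Set Y))).comp_aestronglyMeasurable
    hdiff).aemeasurable.congr ?_
  filter_upwards [ae_and_ae_add hh hvu] with t ht
  exact (normIn_eq_infEDist_ker ι j (by rw [map_sub, map_sub, ht.1, ht.2])).symm

theorem eLpNorm_shift_le (hu : MemLpCone M ι j p T u) (hp : 1 ≤ p) {ε L : ℝ≥0}
    (hE : EhrlingWith M ι j ε L) {h : ℝ} (hh : 0 ≤ h) :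
    eLpNorm (fun t => u (t + h) - u t) p (volume.restrict (Ioo 0 (T - h))) ≤
      ε * (2 * eLpNorm (fun t => M.semi (u t)) p (volume.restrict (Ioo 0 T))) +
        L * shiftNorm ι j p T u h := by
  have hY : ∀ᵐ t ∂(volume.restrict (Ioo 0 T)), InSpace ι j (u t) := by
    obtain ⟨v, -, hv⟩ := hu.measurable_in
    exact hv.mono fun t ht => ⟨v t, ht⟩
  have hsemi := hu.memLp_semi.1
  have hpair : AEMeasurable (fun t => ‖M.semi (u (t + h))‖ₑ + ‖M.semi (u t)‖ₑ)
      (volume.restrict (Ioo 0 (T - h))) :=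
    (aestronglyMeasurable_add_Ioo hh hsemi).enorm.add
      (hsemi.mono_measure (restrict_Ioo_sub_le T hh)).enorm
  calc _ ≤ eLpNorm (fun t => ε * (‖M.semi (u (t + h))‖ₑ + ‖M.semi (u t)‖ₑ) +
          L * normIn ι j (u (t + h) - u t)) p (volume.restrict (Ioo 0 (T - h))) := by
        refine eLpNorm_mono_enorm_ae ?_
        filter_upwards [ae_and_ae_add hh (hu.mem_cone.and hY)] with t ⟨ht, hth⟩
        exact hE _ hth.1 _ ht.1 hth.2 ht.2
    _ ≤ ε * eLpNorm (fun t => ‖M.semi (u (t + h))‖ₑ + ‖M.semi (u t)‖ₑ) p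
          (volume.restrict (Ioo 0 (T - h))) + L * shiftNorm ι j p T u h :=
        eLpNorm_mul_add_mul_le ε L hpair (hu.aemeasurable_normIn_sub hh) hp
    _ ≤ _ := by
        gcongr
        exact eLpNorm_enorm_add_enorm_shift_le (f := fun t => M.semi (u t)) hh hp hsemi

end MemLpCone

end

theorem exists_eventually_eLpNorm_shift_le {Y : ℕ → Type*} [∀ n, NormedAddCommGroup (Y n)]
    [∀ n, NormedSpace ℝ (Y n)] {M : ℕ → SeminormedCone B} {ι : B →ₗ[ℝ] E}
    {j : ∀ n, Y n →ₗ[ℝ] E} {p : ℝ≥0∞} (hp : 1 ≤ p) {T : ℝ}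
    {u : ℕ → ℝ → B} (hu : ∀ n, MemLpCone (M n) ι (j n) p T (u n)) {C : ℝ≥0}
    (hC : ∀ n, eLpNorm (fun t => (M n).semi (u n t)) p (volume.restrict (Ioo 0 T)) ≤ C)
    (hshift : Tendsto (fun h : ℝ => ⨆ n, shiftNorm ι (j n) p T (u n) h) (𝓝[>] 0) (𝓝 0))
    {l : Filter ℕ} (hE : ∀ ε : ℝ≥0, ε ≠ 0 → ∃ L : ℝ≥0, ∀ᶠ n in l, EhrlingWith (M n) ι (j n) ε L)
    {ε : ℝ≥0} (hε : ε ≠ 0) :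
    ∃ δ > 0, ∀ᶠ n in l, ∀ r ∈ Ioo 0 δ,
      eLpNorm (fun t => u n (t + r) - u n t) p (volume.restrict (Ioo 0 (T - r))) ≤ ε := by
  obtain ⟨η, hη, hηε⟩ : ∃ η : ℝ≥0, η ≠ 0 ∧ η * (2 * C) ≤ ε / 2 := by
    refine ⟨ε / 2 / (2 * C + 1), by positivity, ?_⟩
    rw [div_mul_eq_mul_div]
    exact div_le_of_le_mul₀ (by positivity) (by positivity) (by gcongr; exact le_self_add)
  obtain ⟨L, hL⟩ := hE η hη
  have hsmall : ∀ᶠ h in 𝓝[>] (0 : ℝ), L * ⨆ n, shiftNorm ι (j n) p T (u n) h ≤ (ε / 2 : ℝ≥0) := by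
    have hlim := ENNReal.Tendsto.const_mul hshift (Or.inr (ENNReal.coe_ne_top (r := L)))
    rw [mul_zero] at hlim
    exact hlim.eventually_le_const (by positivity)
  obtain ⟨δ, hδ, hδs⟩ := mem_nhdsGT_iff_exists_Ioo_subset.1 hsmall
  refine ⟨δ, hδ, hL.mono fun n hn r hr => ((hu n).eLpNorm_shift_le hp hn hr.1.le).trans ?_⟩
  calc _ ≤ (η : ℝ≥0∞) * (2 * C) + L * ⨆ n, shiftNorm ι (j n) p T (u n) r := by
        gcongr
        · exact hC n
        · exact le_iSup (fun n => shiftNorm ι (j n) p T (u n) r) n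
    _ ≤ (ε / 2 : ℝ≥0) + (ε / 2 : ℝ≥0) := add_le_add (by exact_mod_cast hηε) (hδs hr)
    _ = ε := by rw [← ENNReal.coe_add, add_halves]

end

/-! ### Relative compactness in `L^p` -/

section

theorem natFloor_div_eq_iff {t h : ℝ} (hh : 0 < h) (ht : 0 ≤ t) (k : ℕ) :
    ⌊t / h⌋₊ = k ↔ k * h ≤ t ∧ t < (k + 1) * h := by
  rw [Nat.floor_eq_iff (div_nonneg ht hh.le), le_div_iff₀ hh, div_lt_iff₀ hh]

theorem exists_partition_Ioo {T δ : ℝ} (hT : 0 < T) (hδ : 0 < δ) :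
    ∃ h ∈ Ioc 0 δ, ∃ (K : ℕ) (c : ℝ → Fin (K + 1)), Measurable c ∧
      (∀ k, ENNReal.ofReal h ≤ volume.restrict (Ioo 0 T) (c ⁻¹' {k})) ∧
      ∀ s ∈ Ioo 0 T, ∀ t ∈ Ioo 0 T, c s = c t → dist s t < h := by
  obtain ⟨K, hK⟩ := exists_nat_gt (T / δ)
  set h := T / (K + 1)
  have hh : 0 < h := by positivity
  have hhδ : h ≤ δ := div_le_of_le_mul₀ (by positivity) hδ.le
    ((div_le_iff₀' hδ).1 (hK.le.trans (lt_add_one _).le))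
  have hhT : (K + 1) * h = T := mul_div_cancel₀ T (by positivity)
  set c : ℝ → Fin (K + 1) := fun t => Fin.ofNat (K + 1) ⌊t / h⌋₊
  have hcm : Measurable c := (measurable_from_top (f := Fin.ofNat (K + 1))).comp
    (Nat.measurable_floor.comp (measurable_id.div_const h))
  refine ⟨h, ⟨hh, hhδ⟩, K, c, hcm, fun k => ?_, fun s hs t ht hst => ?_⟩
  · have hsub : Ioo (k * h) ((k + 1) * h) ⊆ c ⁻¹' {k} ∩ Ioo 0 T := by
      intro t ht
      have ht0 : 0 < t := (by positivity : 0 ≤ k * h).trans_lt ht.1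
      have hkK : (k : ℝ) + 1 ≤ K + 1 := by exact_mod_cast k.2
      refine ⟨?_, ht0, ht.2.trans_le ((mul_le_mul_of_nonneg_right hkK hh.le).trans_eq hhT)⟩
      simp [c, (natFloor_div_eq_iff hh ht0.le k).2 ⟨ht.1.le, ht.2⟩]
    calc ENNReal.ofReal h = volume (Ioo (k * h) ((k + 1) * h)) := by
          rw [Real.volume_Ioo, add_one_mul, add_sub_cancel_left]
      _ ≤ volume (c ⁻¹' {k} ∩ Ioo 0 T) := measure_mono hsub
      _ = _ := (Measure.restrict_apply (hcm (measurableSet_singleton k))).symm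
  · have hlt : ∀ t ∈ Ioo 0 T, ⌊t / h⌋₊ < K + 1 := fun t ht => by
      rw [Nat.floor_lt (div_nonneg ht.1.le hh.le), div_lt_iff₀ hh]
      exact_mod_cast ht.2.trans_eq hhT.symm
    have hfloor : ⌊s / h⌋₊ = ⌊t / h⌋₊ := by
      simpa [c, Fin.ext_iff, Nat.mod_eq_of_lt (hlt s hs), Nat.mod_eq_of_lt (hlt t ht)] using hst
    have hs' := (natFloor_div_eq_iff hh hs.1.le _).1 hfloor
    have ht' := (natFloor_div_eq_iff hh ht.1.le _).1 rfl
    rw [Real.dist_eq, abs_lt]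
    constructor <;> linarith

theorem rpow_two_div_mul_fiberOscillation_le {F κ : Type*} [NormedAddCommGroup F] {u : ℝ → F}
    {c : ℝ → κ} {T h : ℝ} (hh : 0 < h) (hc : ∀ s ∈ Ioo 0 T, ∀ t ∈ Ioo 0 T, c s = c t → dist s t < h)
    (hu : AEStronglyMeasurable u (volume.restrict (Ioo 0 T))) {p : ℝ≥0∞} (hp : 1 ≤ p) {ω : ℝ≥0∞}
    (hω : ∀ r ∈ Ioo 0 h,
      eLpNorm (fun t => u (t + r) - u t) p (volume.restrict (Ioo 0 (T - r))) ≤ ω) :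
    (2 / ENNReal.ofReal h) ^ (1 / p.toReal) *
      fiberOscillation c u p (volume.restrict (Ioo 0 T)) ≤ 4 * ω := by
  have hp0 : p ≠ 0 := (one_pos.trans_le hp).ne'
  have hsub : ((volume.restrict (Ioo 0 T)).prod (volume.restrict (Ioo 0 T))).restrict
      {z : ℝ × ℝ | c z.1 = c z.2} ≤ ((volume.restrict (Ioo 0 T)).prod
        (volume.restrict (Ioo 0 T))).restrict {z : ℝ × ℝ | dist z.1 z.2 < h} := by
    refine Measure.restrict_mono_ae ?_
    rw [Measure.prod_restrict]
    filter_upwards [ae_restrict_mem (measurableSet_Ioo.prod measurableSet_Ioo)] with z hz hcz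
    exact hc _ hz.1 _ hz.2 hcz
  have hfactor : (2 / ENNReal.ofReal h) * ENNReal.ofReal (2 * h) = 4 := by
    rw [ENNReal.ofReal_mul zero_le_two, ENNReal.ofReal_ofNat, mul_comm 2 (ENNReal.ofReal h),
      ← mul_assoc, ENNReal.div_mul_cancel (by simpa using hh) ENNReal.ofReal_ne_top]
    norm_num
  have hexp : 1 / p.toReal ≤ 1 := by
    rcases eq_or_ne p ∞ with rfl | hp'
    · simp
    · exact div_le_one_of_le₀ (ENNReal.toReal_mono hp' hp) ENNReal.toReal_nonneg
  calc _ ≤ (2 / ENNReal.ofReal h) ^ (1 / p.toReal) *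
        (ENNReal.ofReal (2 * h) ^ (1 / p.toReal) * ω) := by
        gcongr
        exact (eLpNorm_mono_measure _ hsub).trans (eLpNorm_sub_nearDiagonal_le hu hp0 hω)
    _ = 4 ^ (1 / p.toReal) * ω := by
        rw [← mul_assoc, ← ENNReal.mul_rpow_of_nonneg _ _ (by positivity), hfactor]
    _ ≤ 4 * ω := by
        gcongr
        exact (ENNReal.rpow_le_rpow_of_exponent_le (by norm_num) hexp).trans_eq (ENNReal.rpow_one 4)

end

theorem totallyBounded_range_of_eventually_exists_dist_lt {X I : Type*} [PseudoMetricSpace X]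
    {x : I → X} (h : ∀ ε > 0, ∃ t : Set X, TotallyBounded t ∧
      ∀ᶠ i in cofinite, ∃ y ∈ t, dist (x i) y < ε) : TotallyBounded (range x) := by
  refine Metric.totallyBounded_iff.2 fun ε hε => ?_
  obtain ⟨t, ht, hxt⟩ := h (ε / 2) (half_pos hε)
  obtain ⟨s, hs, hts⟩ := Metric.totallyBounded_iff.1 ht (ε / 2) (half_pos hε)
  refine ⟨s ∪ x '' {i | ¬ ∃ y ∈ t, dist (x i) y < ε / 2}, hs.union (Set.Finite.image x hxt), ?_⟩
  rintro _ ⟨i, rfl⟩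
  simp only [mem_iUnion₂, Metric.mem_ball]
  by_cases hi : ∃ y ∈ t, dist (x i) y < ε / 2
  · obtain ⟨y, hyt, hxy⟩ := hi
    obtain ⟨z, hz, hyz⟩ := mem_iUnion₂.1 (hts hyt)
    exact ⟨z, Or.inl hz,
      (dist_triangle _ y _).trans_lt ((add_lt_add hxy hyz).trans_eq (add_halves ε))⟩
  · exact ⟨x i, Or.inr (mem_image_of_mem x hi), by rwa [dist_self]⟩

section

variable {X κ B : Type*} [MeasurableSpace X] {μ : Measure X} [IsFiniteMeasure μ] [Finite κ]
  [MeasurableSpace κ] [MeasurableSingletonClass κ] [NormedAddCommGroup B]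
  {c : X → κ}

theorem memLp_comp_of_finite (hc : Measurable c) (w : κ → B) (p : ℝ≥0∞) :
    MemLp (fun t => w (c t)) p μ := by
  have := Fintype.ofFinite κ
  exact MemLp.of_bound (StronglyMeasurable.of_discrete.comp_measurable hc).aestronglyMeasurable ‖w‖
    (.of_forall fun t => norm_le_pi_norm w (c t))

theorem continuous_toLp_comp_of_finite (hc : Measurable c) (p : ℝ≥0∞) [Fact (1 ≤ p)] :
    Continuous fun w : κ → B => (memLp_comp_of_finite (μ := μ) hc w p).toLp := by
  obtain ⟨K, hK⟩ : ∃ K : ℝ≥0, (K : ℝ≥0∞) = μ univ ^ p.toReal⁻¹ :=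
    ENNReal.canLift.prf _ (ENNReal.rpow_ne_top_of_nonneg (by positivity) (measure_ne_top μ univ))
  have := Fintype.ofFinite κ
  refine LipschitzWith.continuous (K := K) fun v w => ?_
  rw [Lp.edist_toLp_toLp, edist_dist, hK]
  refine eLpNorm_le_of_ae_bound (.of_forall fun t => ?_)
  rw [Pi.sub_apply, ← dist_eq_norm]
  exact dist_le_pi_dist v w (c t)

end

section

variable {X B : Type*} [MeasurableSpace X] {μ : Measure X} [IsFiniteMeasure μ]
  [NormedAddCommGroup B] [NormedSpace ℝ B] {M : ℕ → SeminormedCone B} {p : ℝ≥0∞}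
  {u : ℕ → X → B} {C : ℝ≥0}

theorem exists_isCompact_eventually_eLpNorm_sub_comp_le {κ : Type*} [Finite κ]
    [MeasurableSpace κ] [MeasurableSingletonClass κ] {c : X → κ} (hc : Measurable c) {m : ℝ≥0}
    (hm : m ≠ 0) (hcm : ∀ k, m ≤ μ (c ⁻¹' {k}))
    (hM : ∀ ν : ℕ → ℕ, StrictMono ν → CompactAlong M ν) (hp : p ≠ 0)
    (hu : ∀ n, AEStronglyMeasurable (u n) μ) (hmem : ∀ n, ∀ᵐ t ∂μ, u n t ∈ (M n).carrier)
    (hq : ∀ n, AEStronglyMeasurable (fun t => (M n).semi (u n t)) μ)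
    (hC : ∀ n, eLpNorm (fun t => (M n).semi (u n t)) p μ ≤ C) {ω : ℝ≥0∞}
    (hω : ∀ᶠ n in atTop,
      (2 / m : ℝ≥0∞) ^ (1 / p.toReal) * fiberOscillation c (u n) p μ ≤ ω) :
    ∃ S : Set (κ → B), IsCompact S ∧
      ∀ᶠ n in atTop, ∃ w ∈ S, eLpNorm (fun t => u n t - w (c t)) p μ ≤ ω := by
  obtain ⟨N, hN⟩ := eventually_atTop.1 hω
  choose s hs hle using fun n => exists_section_eLpNorm_sub_le hc hm hcm (hmem (n + N)) (hu (n + N))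
    (hq (n + N)) hp
  have hbound : ∀ k n, (M (n + N)).semi (u (n + N) (s n k)) ≤
      ((2 / m : ℝ≥0∞) ^ (1 / p.toReal) * C).toReal := fun k n => by
    refine (Real.le_norm_self _).trans ?_
    rw [← toReal_enorm]
    refine ENNReal.toReal_mono (ENNReal.mul_ne_top (ENNReal.rpow_ne_top_of_nonneg (by positivity)
      (ENNReal.div_ne_top ENNReal.ofNat_ne_top (by exact_mod_cast hm))) ENNReal.coe_ne_top) ?_
    exact (hs n k).2.trans (mul_le_mul_right (hC _) _)
  refine ⟨univ.pi fun k => closure (range fun n => u (n + N) (s n k)),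
    isCompact_univ_pi fun k => hM (· + N) (strictMono_id.add_const N) _
      (fun n => (hs n k).1) ⟨_, hbound k⟩, eventually_atTop.2 ⟨N, fun n hn => ?_⟩⟩
  obtain ⟨n, rfl⟩ := Nat.exists_eq_add_of_le' hn
  exact ⟨fun k => u (n + N) (s n k), fun k _ => subset_closure (mem_range_self n),
    (hle n).trans (hN _ hn)⟩

theorem isCompact_closure_range_toLp [CompleteSpace B] [Fact (1 ≤ p)]
    (hM : ∀ ν : ℕ → ℕ, StrictMono ν → CompactAlong M ν) (hLp : ∀ n, MemLp (u n) p μ)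
    (hmem : ∀ n, ∀ᵐ t ∂μ, u n t ∈ (M n).carrier)
    (hq : ∀ n, AEStronglyMeasurable (fun t => (M n).semi (u n t)) μ)
    (hC : ∀ n, eLpNorm (fun t => (M n).semi (u n t)) p μ ≤ C)
    (hosc : ∀ ε : ℝ≥0, ε ≠ 0 → ∃ m : ℝ≥0, m ≠ 0 ∧ ∃ (K : ℕ) (c : X → Fin K), Measurable c ∧
      (∀ k, m ≤ μ (c ⁻¹' {k})) ∧ ∀ᶠ n in atTop,
        (2 / m : ℝ≥0∞) ^ (1 / p.toReal) * fiberOscillation c (u n) p μ ≤ ε) :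
    IsCompact (closure (range fun n => (hLp n).toLp (u n))) := by
  suffices h : TotallyBounded (range fun n => (hLp n).toLp (u n)) from
    h.closure.isCompact_of_isClosed isClosed_closure
  have hp : p ≠ 0 := (one_pos.trans_le (Fact.out : 1 ≤ p)).ne'
  refine totallyBounded_range_of_eventually_exists_dist_lt fun ε hε => ?_
  lift ε to ℝ≥0 using hε.le
  obtain ⟨m, hm, K, c, hc, hcm, hω⟩ := hosc (ε / 2) (half_pos (NNReal.coe_pos.1 hε)).ne'
  obtain ⟨S, hS, hSu⟩ := exists_isCompact_eventually_eLpNorm_sub_comp_le hc hm hcm hM hp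
    (fun n => (hLp n).1) hmem hq hC hω
  refine ⟨_, (hS.image (continuous_toLp_comp_of_finite hc p)).totallyBounded, ?_⟩
  rw [Nat.cofinite_eq_atTop]
  filter_upwards [hSu] with n ⟨w, hw, hle⟩
  refine ⟨_, mem_image_of_mem _ hw, ?_⟩
  rw [dist_edist, Lp.edist_toLp_toLp]
  exact (ENNReal.toReal_mono ENNReal.coe_ne_top hle).trans_lt (half_lt_self hε)

end

theorem exists_partition_Ioo_eventually_fiberOscillation_le {B : Type*} [NormedAddCommGroup B]
    {u : ℕ → ℝ → B} {T : ℝ} (hT : 0 < T) {p : ℝ≥0∞} (hp : 1 ≤ p)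
    (hu : ∀ n, AEStronglyMeasurable (u n) (volume.restrict (Ioo 0 T)))
    {l : Filter ℕ} {ε : ℝ≥0} {δ : ℝ} (hδ : 0 < δ) (hω : ∀ᶠ n in l, ∀ r ∈ Ioo 0 δ,
      eLpNorm (fun t => u n (t + r) - u n t) p (volume.restrict (Ioo 0 (T - r))) ≤ ε / 4) :
    ∃ m : ℝ≥0, m ≠ 0 ∧ ∃ (K : ℕ) (c : ℝ → Fin K), Measurable c ∧
      (∀ k, m ≤ volume.restrict (Ioo 0 T) (c ⁻¹' {k})) ∧ ∀ᶠ n in l, (2 / m : ℝ≥0∞) ^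
        (1 / p.toReal) * fiberOscillation c (u n) p (volume.restrict (Ioo 0 T)) ≤ ε := by
  obtain ⟨h, ⟨hh, hhδ⟩, K, c, hc, hch, hdist⟩ := exists_partition_Ioo hT hδ
  refine ⟨h.toNNReal, (Real.toNNReal_pos.2 hh).ne', K + 1, c, hc, hch, ?_⟩
  filter_upwards [hω] with n hn
  refine (rpow_two_div_mul_fiberOscillation_le hh hdist (hu n) hp
    fun r hr => hn r (Ioo_subset_Ioo_right hhδ hr)).trans_eq ?_
  exact ENNReal.mul_div_cancel four_ne_zero ENNReal.ofNat_ne_top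

/-! ### Continuous representatives -/

section

variable {X B : Type*} [PseudoMetricSpace X] [SecondCountableTopology X] [MeasurableSpace X]
  {μ : Measure X} [PseudoMetricSpace B] {f : X → B}

theorem exists_ae_mem_uniformContinuousOn (hf : ∀ ε > 0, ∃ δ > 0, ∀ᵐ s ∂μ, ∀ᵐ t ∂μ,
      dist s t < δ → dist (f s) (f t) ≤ ε) :
    ∃ G : Set X, (∀ᵐ t ∂μ, t ∈ G) ∧ UniformContinuousOn f G := by
  choose! δ hδ h using hf
  set e : ℕ → ℝ := fun n => 1 / (n + 1)
  have he : ∀ n, 0 < e n := fun n => Nat.one_div_pos_of_nat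
  refine ⟨{s | s ∈ μ.support ∧ ∀ n, ∀ᵐ t ∂μ, dist s t < δ (e n) → dist (f s) (f t) ≤ e n},
    eventually_and.2 ⟨Measure.support_mem_ae, ae_all_iff.2 fun n => h _ (he n)⟩, ?_⟩
  refine Metric.uniformContinuousOn_iff_le.2 fun ε hε => ?_
  obtain ⟨n, hn⟩ := exists_nat_one_div_lt (half_pos hε)
  refine ⟨δ (e n) / 2, half_pos (hδ _ (he n)), fun x hx y hy hxy => ?_⟩
  have hball : ∃ᵐ t ∂μ, t ∈ Metric.ball x (δ (e n) / 2) := frequently_ae_mem_iff.2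
    ((Measure.mem_support_iff_forall _).1 hx.1 _
      (Metric.ball_mem_nhds x (half_pos (hδ _ (he n))))).ne'
  obtain ⟨t, ht, hxt, hyt⟩ := (hball.and_eventually ((hx.2 n).and (hy.2 n))).exists
  rw [Metric.mem_ball'] at ht
  have hyt' : dist y t < δ (e n) := (dist_triangle_left y t x).trans_lt
    ((add_lt_add_of_le_of_lt hxy ht).trans_eq (add_halves _))
  calc dist (f x) (f y) ≤ dist (f x) (f t) + dist (f y) (f t) := dist_triangle_right _ _ _
    _ ≤ e n + e n := add_le_add (hxt (ht.trans (half_lt_self (hδ _ (he n))))) (hyt hyt')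
    _ ≤ ε := by linarith

end

section

variable {T : ℝ}

theorem dense_preimage_Icc_of_ae (hT : 0 < T) {G : Set ℝ}
    (hG : ∀ᵐ t ∂(volume.restrict (Ioo 0 T)), t ∈ G) :
    Dense ((↑) ⁻¹' G : Set (Icc (0 : ℝ) T)) := by
  refine dense_iff_inter_open.2 ?_
  rintro _ ⟨V, hV, rfl⟩ ⟨x, hx⟩
  have hVT : (V ∩ Ioo 0 T).Nonempty :=
    mem_closure_iff.1 ((closure_Ioo hT.ne).symm ▸ x.2) V hV hx
  have hfreq : ∃ᵐ t ∂volume, t ∈ V ∩ Ioo 0 T :=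
    frequently_ae_mem_iff.2 ((hV.inter isOpen_Ioo).measure_pos volume hVT).ne'
  obtain ⟨t, ht, htG⟩ :=
    (hfreq.and_eventually ((ae_restrict_iff' measurableSet_Ioo).1 hG)).exists
  exact ⟨⟨t, Ioo_subset_Icc_self ht.2⟩, ht.1, htG ht.2⟩

theorem exists_continuousMap_ae_eq {B : Type*} [MetricSpace B] [CompleteSpace B] (hT : 0 < T)
    {f : ℝ → B} (hf : ∀ ε > 0, ∃ δ > 0, ∀ᵐ s ∂(volume.restrict (Ioo 0 T)),
      ∀ᵐ t ∂(volume.restrict (Ioo 0 T)), dist s t < δ → dist (f s) (f t) ≤ ε) :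
    ∃ U : C(Icc (0 : ℝ) T, B),
      ∀ᵐ t ∂(volume.restrict (Ioo 0 T)), ∀ ht : t ∈ Icc 0 T, f t = U ⟨t, ht⟩ := by
  obtain ⟨G, hG, hfG⟩ := exists_ae_mem_uniformContinuousOn hf
  set D : Set (Icc (0 : ℝ) T) := (↑) ⁻¹' G
  have hD : Dense D := dense_preimage_Icc_of_ae hT hG
  have huc : UniformContinuous fun x : D => f x :=
    (uniformContinuousOn_iff_restrict.1 hfG).comp
      (f := fun x : D => (⟨x, x.2⟩ : G)) ((uniformContinuous_subtype_val.comp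
        uniformContinuous_subtype_val).subtype_mk _)
  refine ⟨⟨hD.extend fun x : D => f x, (hD.uniformContinuous_extend huc).continuous⟩, ?_⟩
  filter_upwards [hG] with t htG ht
  exact (hD.extend_of_ind huc ⟨⟨t, ht⟩, htG⟩).symm

variable {B : Type*} [NormedAddCommGroup B]

theorem ae_ae_dist_le_of_eLpNorm_shift_le {u : ℝ → B} {h : ℝ} {ω : ℝ≥0}
    (hu : AEStronglyMeasurable u (volume.restrict (Ioo 0 T))) (hω : ∀ r ∈ Ioo 0 h,
      eLpNorm (fun t => u (t + r) - u t) ∞ (volume.restrict (Ioo 0 (T - r))) ≤ ω) :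
    ∀ᵐ s ∂(volume.restrict (Ioo 0 T)), ∀ᵐ t ∂(volume.restrict (Ioo 0 T)),
      dist s t < h → dist (u s) (u t) ≤ ω := by
  have hle := eLpNorm_sub_nearDiagonal_le hu ENNReal.top_ne_zero hω
  rw [ENNReal.toReal_top, div_zero, ENNReal.rpow_zero, one_mul, eLpNorm_exponent_top] at hle
  suffices hprod : ∀ᵐ z ∂(volume.restrict (Ioo 0 T)).prod (volume.restrict (Ioo 0 T)),
      dist z.1 z.2 < h → dist (u z.1) (u z.2) ≤ ω from Measure.ae_ae_of_ae_prod hprod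
  refine (ae_restrict_iff'
    (measurableSet_lt (measurable_fst.dist measurable_snd) measurable_const)).1 ?_
  filter_upwards [ae_le_eLpNormEssSup (f := fun z : ℝ × ℝ => u z.2 - u z.1)] with z hz
  rw [dist_comm, dist_eq_norm]
  exact enorm_le_coe.1 (hz.trans hle)

theorem exists_continuousMap_ae_eq_of_eLpNorm_shift_le [CompleteSpace B] (hT : 0 < T) {u : ℝ → B}
    (hu : AEStronglyMeasurable u (volume.restrict (Ioo 0 T)))
    (hω : ∀ ε : ℝ≥0, ε ≠ 0 → ∃ δ > 0, ∀ r ∈ Ioo 0 δ,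
      eLpNorm (fun t => u (t + r) - u t) ∞ (volume.restrict (Ioo 0 (T - r))) ≤ ε) :
    ∃ U : C(Icc (0 : ℝ) T, B),
      ∀ᵐ t ∂(volume.restrict (Ioo 0 T)), ∀ ht : t ∈ Icc 0 T, u t = U ⟨t, ht⟩ := by
  refine exists_continuousMap_ae_eq hT fun ε hε => ?_
  lift ε to ℝ≥0 using hε.le
  obtain ⟨δ, hδ, h⟩ := hω ε (NNReal.coe_pos.1 hε).ne'
  exact ⟨δ, hδ, ae_ae_dist_le_of_eLpNorm_shift_le hu h⟩

theorem dist_continuousMap_le_dist_toLp (hT : 0 < T) {u v : ℝ → B}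
    (hu : MemLp u ∞ (volume.restrict (Ioo 0 T))) (hv : MemLp v ∞ (volume.restrict (Ioo 0 T)))
    {U V : C(Icc (0 : ℝ) T, B)}
    (hU : ∀ᵐ t ∂(volume.restrict (Ioo 0 T)), ∀ ht : t ∈ Icc 0 T, u t = U ⟨t, ht⟩)
    (hV : ∀ᵐ t ∂(volume.restrict (Ioo 0 T)), ∀ ht : t ∈ Icc 0 T, v t = V ⟨t, ht⟩) :
    dist U V ≤ dist (hu.toLp u) (hv.toLp v) := by
  set d := dist (hu.toLp u) (hv.toLp v)
  have hae : ∀ᵐ t ∂(volume.restrict (Ioo 0 T)), ∀ ht : t ∈ Icc 0 T,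
      dist (U ⟨t, ht⟩) (V ⟨t, ht⟩) ≤ d := by
    filter_upwards [hU, hV, ae_le_eLpNormEssSup (f := u - v)] with t hUt hVt huv ht
    rw [← hUt ht, ← hVt ht]
    rw [← eLpNorm_exponent_top, ← Lp.edist_toLp_toLp _ _ hu hv, Pi.sub_apply,
      ← edist_eq_enorm_sub, edist_dist, edist_dist] at huv
    exact (ENNReal.ofReal_le_ofReal_iff dist_nonneg).1 huv
  have hclosed : IsClosed {x : Icc (0 : ℝ) T | dist (U x) (V x) ≤ d} :=
    isClosed_le (by fun_prop) continuous_const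
  have hsub : ((↑) ⁻¹' {t | ∀ ht : t ∈ Icc 0 T, dist (U ⟨t, ht⟩) (V ⟨t, ht⟩) ≤ d} :
      Set (Icc (0 : ℝ) T)) ⊆ {x | dist (U x) (V x) ≤ d} := fun y hy => hy y.2
  refine (ContinuousMap.dist_le dist_nonneg).2 fun x => ?_
  exact closure_minimal hsub hclosed (dense_preimage_Icc_of_ae hT hae x)

end

theorem totallyBounded_range_of_dist_le {I X Y : Type*} [PseudoMetricSpace X]
    [PseudoMetricSpace Y] {x : I → X} {y : I → Y} (hx : TotallyBounded (range x))
    (h : ∀ i i', dist (y i) (y i') ≤ dist (x i) (x i')) : TotallyBounded (range y) := by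
  let _ : PseudoMetricSpace I := PseudoMetricSpace.induced x inferInstance
  have huniv : TotallyBounded (univ : Set I) := by
    simpa only [preimage_range] using totallyBounded_preimage (f := x) ⟨rfl⟩ hx
  rw [← image_univ]
  exact huniv.image (LipschitzWith.mk_one h).uniformContinuous

theorem mainTheorem7_general {B : Type*} [NormedAddCommGroup B] [NormedSpace ℝ B]
    [CompleteSpace B] {Y : ℕ → Type*} [∀ n, NormedAddCommGroup (Y n)] [∀ n, NormedSpace ℝ (Y n)]
    {E : Type*} [AddCommGroup E] [Module ℝ E] (ι : B →ₗ[ℝ] E) (j : ∀ n, Y n →ₗ[ℝ] E)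
    (M : ℕ → SeminormedCone B)
    (hcont : ∀ n, (M n).ContinuouslyEmbedded)
    (hcompact : CompactAlong M id)
    (hcompat : ∀ ν : ℕ → ℕ, StrictMono ν → CompatibleAlong M ι j ν)
    (p : ℝ≥0∞) [Fact (1 ≤ p)] (T : ℝ) (hT : 0 < T)
    (u : ℕ → ℝ → B)
    (hu : ∀ n, MemLpCone (M n) ι (j n) p T (u n))
    (hbound : ∃ C : ℝ≥0, ∀ n,
      eLpNorm (fun t => (M n).semi (u n t)) p (volume.restrict (Ioo 0 T)) ≤ C)
    (hshift : Tendsto (fun h : ℝ => ⨆ n, shiftNorm ι (j n) p T (u n) h) (𝓝[>] 0) (𝓝 0)) :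
    (∃ hLp : ∀ n, MemLp (u n) p (volume.restrict (Ioo 0 T)),
      IsCompact (closure (range fun n => (hLp n).toLp (u n)))) ∧
    (p = ∞ → (∀ n, CompactAlong M fun _ => n) → (∀ n, CompatibleAlong M ι j fun _ => n) →
      ∃ U : ℕ → C(Icc (0 : ℝ) T, B),
        (∀ n, ∀ᵐ t ∂(volume.restrict (Ioo 0 T)), ∀ ht : t ∈ Icc 0 T, u n t = U n ⟨t, ht⟩) ∧
        IsCompact (closure (range U))) := by
  obtain ⟨C, hC⟩ := hbound
  have hp : 1 ≤ p := Fact.out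
  have hM : ∀ ν : ℕ → ℕ, StrictMono ν → CompactAlong M ν := fun ν hν =>
    hcompact.comp_strictMono (fun n => (hu n).nonempty hT) hν
  have hLp : ∀ n, MemLp (u n) p (volume.restrict (Ioo 0 T)) := fun n => (hu n).memLp (hcont n)
  have hLpCompact : IsCompact (closure (range fun n => (hLp n).toLp (u n))) := by
    refine isCompact_closure_range_toLp hM hLp (fun n => (hu n).mem_cone)
      (fun n => (hu n).memLp_semi.1) hC fun ε hε => ?_
    obtain ⟨δ, hδ, hω⟩ := exists_eventually_eLpNorm_shift_le (l := atTop) (ε := ε / 4) hp hu hC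
      hshift (fun η hη => exists_eventually_ehrlingWith hM hcompat hη) (by positivity)
    exact exists_partition_Ioo_eventually_fiberOscillation_le hT hp (fun n => (hLp n).1) hδ
      (by simpa using hω)
  refine ⟨⟨hLp, hLpCompact⟩, ?_⟩
  rintro rfl hcompactn hcompatn
  have hrep : ∀ n, ∃ U : C(Icc (0 : ℝ) T, B),
      ∀ᵐ t ∂(volume.restrict (Ioo 0 T)), ∀ ht : t ∈ Icc 0 T, u n t = U ⟨t, ht⟩ := fun n =>
    exists_continuousMap_ae_eq_of_eLpNorm_shift_le hT (hu n).1 fun ε hε => by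
      simpa using exists_eventually_eLpNorm_shift_le (l := pure n) hp hu hC hshift
        (fun η hη => (exists_ehrlingWith_along (hcompactn n) (fun _ _ => hcompatn n) hη).imp'
          Nat.cast fun k hk => by simpa using hk) hε
  choose U hU using hrep
  have htot : TotallyBounded (range U) := totallyBounded_range_of_dist_le
    (hLpCompact.totallyBounded.subset subset_closure) fun n n' =>
      dist_continuousMap_le_dist_toLp hT (hLp n) (hLp n') (hU n) (hU n')
  exact ⟨U, hU, htot.closure.isCompact_of_isClosed isClosed_closure⟩

theorem mainTheorem7 {B : Type*} [NormedAddCommGroup B] [NormedSpace ℝ B] [CompleteSpace B]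
    {Y : ℕ → Type*} [∀ n, NormedAddCommGroup (Y n)] [∀ n, NormedSpace ℝ (Y n)]
    [∀ n, CompleteSpace (Y n)]
    {E : Type*} [AddCommGroup E] [Module ℝ E]
    (ι : B →ₗ[ℝ] E) (hι : Function.Injective ι)
    (j : ∀ n, Y n →ₗ[ℝ] E) (hj : ∀ n, Function.Injective (j n))
    (M : ℕ → SeminormedCone B)
    (hcont : ∀ n, (M n).ContinuouslyEmbedded)
    (hcompact : CompactAlong M id)
    (hcompat : ∀ ν : ℕ → ℕ, StrictMono ν → CompatibleAlong M ι j ν)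
    (p : ℝ≥0∞) [Fact (1 ≤ p)] (T : ℝ) (hT : 0 < T)
    (u : ℕ → ℝ → B)
    (hu : ∀ n, MemLpCone (M n) ι (j n) p T (u n))
    (hbound : ∃ C : ℝ≥0, ∀ n,
      eLpNorm (fun t => (M n).semi (u n t)) p (volume.restrict (Ioo 0 T)) ≤ C)
    (hshift : Tendsto (fun h : ℝ => ⨆ n, shiftNorm ι (j n) p T (u n) h) (𝓝[>] 0) (𝓝 0)) :
    (∃ hLp : ∀ n, MemLp (u n) p (volume.restrict (Ioo 0 T)),
      IsCompact (closure (range fun n => (hLp n).toLp (u n)))) ∧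
    (p = ∞ → (∀ n, CompactAlong M fun _ => n) → (∀ n, CompatibleAlong M ι j fun _ => n) →
      ∃ U : ℕ → C(Icc (0 : ℝ) T, B),
        (∀ n, ∀ᵐ t ∂(volume.restrict (Ioo 0 T)), ∀ ht : t ∈ Icc 0 T, u n t = U n ⟨t, ht⟩) ∧
        IsCompact (closure (range U))) := by
  exact mainTheorem7_general ι j M hcont hcompact hcompat p T hT u hu hbound hshift
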